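/- **Setting.** A bandit instance $\nu=(\nu_1,\dots,\nu_K)$ consists of $K\ge 2$ probability distributions on $\mathbb{R}$ with means $\mu_i$; the rewards $X^i_s$ ($s\ge 1$) of arm $i$ are i.i.d. with law $\nu_i$, independent across arms. A bandit algorithm consists, for every horizon $T$ and every number of arms $K\ge 2$, of decision rules $\pi_t(\cdot\mid \mathcal H_{t-1})$ (possibly depending on $T$): the arm $A_t\in[K]$ is drawn from $\pi_t(\cdot\mid\mathcal H_{t-1})$, where $\mathcal H_{t-1}=(A_1,r_1,\dots,A_{t-1},r_{t-1})$, and the reward is $r_t=X^{A_t}_{N_{A_t,t}}$ with $N_{i,t}=\sum_{s\le t}\mathbf 1\{A_s=i\}$. Put $\Delta_i=\max_j\mu_j-\mu_i$, $R_T(\nu)=\sum_i\Delta_i\,\mathbb E[N_{i,T}]$ and $S_T(\nu)=\max_{i}\sqrt{\operatorname{Var}(N_{i,T})}$. Fix $M>0$, $\sigma\ge 1$ and an integer $\bar K\ge 2$, let $\mathfrak P$ be the class of all instances with $2\le K\le\bar K$ arms whose reward distributions are $\sigma$-sub-Gaussian with means in $[-M,M]$, and let $\mathcal R_T=\sup_{\nu\in\mathfrak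 P}R_T(\nu)$. Algorithms are assumed to satisfy, for every $\nu\in\mathfrak P$: (i) $\mathbb E[N_{i,T}]=\mathbb E[N_{j,T}]$ whenever $\nu_i=\nu_j$; (ii) $\mathbb E[N_{i,T}]\ge 1$ for every arm $i$ if $T\ge K$. An algorithm is active-learning if $\mathcal R_T/T\to 0$ as $T\to\infty$. For $\Delta\ge 0$ let $S_T(\Delta)$ denote the value of $S_T$ on the two-armed instance $(\mathcal N(0,1),\mathcal N(-\Delta,1))$. **Statement.** For every $C>0$ there is a constant $c>0$ depending only on $C$ (not on $T$, $\alpha$, $M,\sigma,\bar K$, nor otherwise on the algorithm) such that the following holds for every $\alpha\in[0,\tfrac12)$. For every active-learning algorithm with worst-case regret $\mathcal R_T=\Theta(T^{1/2+\alpha})$ and $\mathcal R_T\le C\,T^{1/2+\alpha}$ for all sufficiently large $T$, $$\sup_{\Delta\in[0,\,c\,T^{\alpha-1/2}]}S_T(\Delta)=\Omega\big(T^{1-\alpha}\big)\qquad\text{as }T\to\infty .$$ -/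

import Mathlib

open MeasureTheory ProbabilityTheory Filter Topology Asymptotics
open scoped NNReal

noncomputable section

namespace Bandit

/-- A bandit instance with `K` arms: the reward distribution of every arm. -/
abbrev Instance (K : ℕ) : Type := Fin K → ProbabilityMeasure ℝ

/-- An observed history `(A₁, r₁, …, A_t, r_t)` of length `t`. -/
abbrev History (K t : ℕ) : Type := Fin t → Fin K × ℝ

/-- The decision rules of a bandit algorithm facing `K` arms: given the observed history of
length `t`, `rule t` is the distribution over the arms from which the next action is drawn. -/
structure Policy (K : ℕ) where
  rule : (t : ℕ) → Kernel (History K t) (Fin K)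
  markov : ∀ t, IsMarkovKernel (rule t)

attribute [instance] Policy.markov

/-- A bandit algorithm: decision rules for every horizon `T` and every number `K ≥ 2` of arms.
The rules may depend on the horizon. -/
abbrev Algorithm : Type := (T K : ℕ) → 2 ≤ K → Policy K

/-- A realization of all the reward sequences: the entry `(i, s)` is the reward of the pull
number `s + 1` of arm `i`. -/
abbrev RewardTable (K : ℕ) : Type := Fin K × ℕ → ℝ

/-- The law of the reward sequences: all entries are independent, and those of arm `i` have
distribution `ν i`. -/
def rewardLaw {K : ℕ} (ν : Instance K) : Measure (RewardTable K) :=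
  Measure.infinitePi fun p : Fin K × ℕ => (ν p.1 : Measure ℝ)

/-- The number of pulls of arm `i` in a sequence of actions. -/
def pullCount {K t : ℕ} (i : Fin K) (a : Fin t → Fin K) : ℕ :=
  (Finset.univ.filter fun s => a s = i).card

/-- The history observed when the actions `a` are played on the reward table `x`: a pull of an
arm that was pulled `n` times before collects the entry `n` of the reward sequence of this arm. -/
def observed {K t : ℕ} (x : RewardTable K) (a : Fin t → Fin K) : History K t :=
  fun s => (a s, x (a s, (Finset.univ.filter fun u => u < s ∧ a u = a s).card))

lemma measurable_observed (K t : ℕ) :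
    Measurable fun p : RewardTable K × (Fin t → Fin K) => observed p.1 p.2 := by
  refine measurable_from_prod_countable_left fun a => ?_
  refine measurable_pi_lambda _ fun s => ?_
  exact Measurable.prodMk measurable_const
    (measurable_pi_apply (a s, (Finset.univ.filter fun u => u < s ∧ a u = a s).card))

/-- The law of the first `t` actions given the reward table: action number `t + 1` is drawn
from `π.rule t` evaluated at the history observed so far. -/
def actionKernel {K : ℕ} (π : Policy K) : (t : ℕ) → Kernel (RewardTable K) (Fin t → Fin K)
  | 0 => Kernel.const _ (Measure.dirac Fin.elim0)
  | t + 1 =>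
      ((actionKernel π t) ⊗ₖ
        ((π.rule t).comap (fun p : RewardTable K × (Fin t → Fin K) => observed p.1 p.2)
          (measurable_observed K t))).map
        (fun q : (Fin t → Fin K) × Fin K => (Fin.snoc q.1 q.2 : Fin (t + 1) → Fin K))

instance {K : ℕ} (π : Policy K) (t : ℕ) : IsMarkovKernel (actionKernel π t) := by
  induction t with
  | zero => unfold actionKernel; infer_instance
  | succ t ih => unfold actionKernel; exact Kernel.IsMarkovKernel.map _ .of_discrete

/-- The law of the first `T` actions when the policy `π` is run on the instance `ν`. -/
def actionLaw {K : ℕ} (π : Policy K) (ν : Instance K) (T : ℕ) : Measure (Fin T → Fin K) :=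
  (rewardLaw ν).bind (actionKernel π T)

/-- The expected pull count `𝔼[N_{i,T}]`. -/
def expectedPulls {K : ℕ} (π : Policy K) (ν : Instance K) (T : ℕ) (i : Fin K) : ℝ :=
  ∫ a, (pullCount i a : ℝ) ∂(actionLaw π ν T)

/-- The mean reward of arm `i`. -/
def mean {K : ℕ} (ν : Instance K) (i : Fin K) : ℝ := ∫ x, x ∂(ν i : Measure ℝ)

/-- The gap of arm `i`. -/
def gap {K : ℕ} (ν : Instance K) (i : Fin K) : ℝ := (⨆ j, mean ν j) - mean ν i

/-- The expected pseudo-regret over the horizon `T`. -/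
def regret {K : ℕ} (π : Policy K) (ν : Instance K) (T : ℕ) : ℝ :=
  ∑ i, gap ν i * expectedPulls π ν T i

/-- The allocation variability: the largest standard deviation of a pull count `N_{i,T}`. -/
def allocVar {K : ℕ} (π : Policy K) (ν : Instance K) (T : ℕ) : ℝ :=
  ⨆ i : Fin K, √(variance (fun a : Fin T → Fin K => (pullCount i a : ℝ)) (actionLaw π ν T))

/-- The instances with `K` arms in the sub-Gaussian class with bounded means: `2 ≤ K ≤ Kbar`,
and every arm has its mean in `[-M, M]` and is `σ`-sub-Gaussian. -/
def InClass (M : ℝ) (σ : ℝ≥0) (Kbar : ℕ) {K : ℕ} (ν : Instance K) : Prop :=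
  2 ≤ K ∧ K ≤ Kbar ∧ ∀ i, mean ν i ∈ Set.Icc (-M) M ∧
    HasSubgaussianMGF (fun x => x - mean ν i) (σ ^ 2) (ν i : Measure ℝ)

/-- The worst-case regret of an algorithm over the sub-Gaussian class. -/
def worstRegret (M : ℝ) (σ : ℝ≥0) (Kbar : ℕ) (A : Algorithm) (T : ℕ) : ℝ :=
  sSup {r | ∃ (K : ℕ) (hK : 2 ≤ K) (ν : Instance K),
    InClass M σ Kbar ν ∧ r = regret (A T K hK) ν T}

/-- The two regularity conditions: arms with the same reward distribution have the same expected
pull count, and every arm is pulled at least once in expectation when `T ≥ K`. -/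
def IsRegular (M : ℝ) (σ : ℝ≥0) (Kbar : ℕ) (A : Algorithm) : Prop :=
  ∀ (T K : ℕ) (hK : 2 ≤ K) (ν : Instance K), InClass M σ Kbar ν →
    (∀ i j, ν i = ν j → expectedPulls (A T K hK) ν T i = expectedPulls (A T K hK) ν T j) ∧
    (K ≤ T → ∀ i, 1 ≤ expectedPulls (A T K hK) ν T i)

/-- An algorithm is active-learning if its worst-case regret is sublinear. -/
def IsActiveLearning (M : ℝ) (σ : ℝ≥0) (Kbar : ℕ) (A : Algorithm) : Prop :=
  Tendsto (fun T : ℕ => worstRegret M σ Kbar A T / T) atTop (𝓝 0)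

/-- The two-armed Gaussian instance with reward distributions `N(0, 1)` and `N(-Δ, 1)`. -/
def gaussianPair (Δ : ℝ) : Instance 2 :=
  ![⟨gaussianReal 0 1, inferInstance⟩, ⟨gaussianReal (-Δ) 1, inferInstance⟩]

/-- The allocation variability `S_T(Δ)` of an algorithm on the two-armed Gaussian instance with
gap `Δ`. -/
def gaussianAllocVar (A : Algorithm) (T : ℕ) (Δ : ℝ) : ℝ :=
  allocVar (A T 2 le_rfl) (gaussianPair Δ) T

end Bandit

end

/-! With two equal arms, symmetry forces `𝔼[N₂] = T/2`. At gap `b = 8C T^(α-1/2)` the regret bound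
reads `b 𝔼[N₂] ≤ C T^(1/2+α) = b T/8`, so `𝔼[N₂] ≤ T/8`. The expected pull count thus falls by at
least `3T/8` over a short interval of gaps.

Such a fall requires variance. The actions are a randomized function of at most `T` rewards per arm,
so moving one Gaussian mean by `δ` costs `χ²`-divergence at most `exp(Tδ²) - 1`. The
Hammersley–Chapman–Robbins bound (`sq_integral_bind_withDensity_sub_le`, `sq_expectedPulls_sub_le`)
then limits the change of `𝔼[N₂]` to about `δ√T` standard deviations. Chaining small steps from `0`
to `b` gives `3T/8 ≤ 2b√T S = 16C T^α S`, with `S` the supremum of the variability on `[0, b]`;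
hence `S ≳ T^(1-α)`. -/

namespace Bandit

/-! ### Variance lower bound under a change of measure -/

/-- The Cauchy–Schwarz inequality for the integral of a product. -/
lemma sq_integral_mul_le {X : Type*} [MeasurableSpace X] {μ : Measure X} {f g : X → ℝ}
    (hf : MemLp f 2 μ) (hg : MemLp g 2 μ) :
    (∫ x, f x * g x ∂μ) ^ 2 ≤ (∫ x, f x ^ 2 ∂μ) * ∫ x, g x ^ 2 ∂μ := by
  have hf2 := hf.integrable_sq
  have hg2 := hg.integrable_sq
  have hfg : Integrable (fun x => f x * g x) μ := hf.integrable_mul hg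
  have h := discrim_le_zero (a := ∫ x, g x ^ 2 ∂μ) (b := 2 * ∫ x, f x * g x ∂μ)
    (c := ∫ x, f x ^ 2 ∂μ) (fun t => by
      have h0 : 0 ≤ ∫ x, (t * t * g x ^ 2 + 2 * t * (f x * g x) + f x ^ 2) ∂μ :=
        integral_nonneg fun x => by
          change 0 ≤ t * t * g x ^ 2 + 2 * t * (f x * g x) + f x ^ 2
          nlinarith [sq_nonneg (t * g x + f x)]
      have h1 : Integrable (fun x => t * t * g x ^ 2 + 2 * t * (f x * g x)) μ :=
        (hg2.const_mul _).add (hfg.const_mul _)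
      rw [integral_add h1 hf2,
        integral_add (hg2.const_mul _) (hfg.const_mul _), integral_const_mul,
        integral_const_mul] at h0
      linarith)
  unfold discrim at h
  nlinarith

/-- Integration against the composition of a measure with a kernel into a finite space. -/
lemma integral_bind_of_finite {X Y : Type*} [MeasurableSpace X] [MeasurableSpace Y] [Finite Y]
    [MeasurableSingletonClass Y] (μ : Measure X) [IsProbabilityMeasure μ] (κ : Kernel X Y)
    [IsMarkovKernel κ] (f : Y → ℝ) :
    ∫ y, f y ∂(μ.bind κ) = ∫ x, ∫ y, f y ∂(κ x) ∂μ := by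
  have h : μ.bind κ = (κ ∘ₖ Kernel.const Unit μ) () := Measure.comp_eq_comp_const_apply
  rw [h, Kernel.integral_comp .of_finite, Kernel.const_apply]

/-- The Hammersley–Chapman–Robbins bound for the mean of a statistic of a randomized observation:
a change of the prior by the density `L` moves the mean by at most the square root of the
`χ²`-divergence times the standard deviation. -/
lemma sq_integral_bind_withDensity_sub_le {X Y : Type*} [MeasurableSpace X] [MeasurableSpace Y]
    [Finite Y] [MeasurableSingletonClass Y] (μ : Measure X) [IsProbabilityMeasure μ]
    (κ : Kernel X Y) [IsMarkovKernel κ] (f : Y → ℝ) {L : X → ℝ} (hL : Measurable L)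
    (hL0 : ∀ x, 0 ≤ L x) (hL2 : MemLp L 2 μ)
    [IsProbabilityMeasure (μ.withDensity fun x => ENNReal.ofReal (L x))] :
    (∫ y, f y ∂((μ.withDensity fun x => ENNReal.ofReal (L x)).bind κ)
        - ∫ y, f y ∂(μ.bind κ)) ^ 2
      ≤ ((∫ x, L x ^ 2 ∂μ) - 1) * variance f (μ.bind κ) := by
  have hprob : IsProbabilityMeasure (μ.bind κ) := by
    have : μ.bind κ = κ ∘ₘ μ := rfl
    rw [this]; infer_instance
  have hfm : Measurable f := measurable_of_finite f
  obtain ⟨B, hB⟩ : ∃ B, ∀ y, ‖f y‖ ≤ B := by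
    obtain ⟨B, hB⟩ := (Set.finite_range fun y => ‖f y‖).bddAbove
    exact ⟨B, fun y => hB ⟨y, rfl⟩⟩
  -- `g` is the conditional mean of the statistic given the observation.
  set g : X → ℝ := fun x => ∫ y, f y ∂(κ x) with hg
  set m : ℝ := ∫ y, f y ∂(μ.bind κ) with hm
  have hmg : m = ∫ x, g x ∂μ := integral_bind_of_finite μ κ f
  have hgm : StronglyMeasurable g := hfm.stronglyMeasurable.integral_kernel
  have hgB : ∀ x, ‖g x‖ ≤ B := fun x => by
    simpa using norm_integral_le_of_norm_le_const (μ := κ x) (ae_of_all _ hB)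
  have hgLp : MemLp g 2 μ := MemLp.of_bound hgm.aestronglyMeasurable B (ae_of_all _ hgB)
  have hL1 : Integrable L μ := hL2.integrable one_le_two
  have hLone : ∫ x, L x ∂μ = 1 := by
    have h1 : (μ.withDensity fun x => ENNReal.ofReal (L x)) Set.univ = 1 := measure_univ
    rw [withDensity_apply _ .univ, Measure.restrict_univ] at h1
    rw [integral_eq_lintegral_of_nonneg_ae (ae_of_all _ hL0) hL.aestronglyMeasurable, h1]
    simp
  have hleft : ∫ y, f y ∂((μ.withDensity fun x => ENNReal.ofReal (L x)).bind κ)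
      = ∫ x, L x * g x ∂μ := by
    rw [integral_bind_of_finite, integral_withDensity_eq_integral_toReal_smul
      hL.ennreal_ofReal (ae_of_all _ fun _ => ENNReal.ofReal_lt_top)]
    refine integral_congr_ae (ae_of_all _ fun x => ?_)
    simp [ENNReal.toReal_ofReal (hL0 x), hg]
  have hLg : Integrable (fun x => L x * g x) μ := hL2.integrable_mul hgLp
  -- Centring both factors is free, since `L` integrates to one and `g` to `m`.
  have hdiff : (∫ x, L x * g x ∂μ) - m = ∫ x, (L x - 1) * (g x - m) ∂μ := by
    have e : (fun x => (L x - 1) * (g x - m)) = fun x => (L x * g x - m * L x) - (g x - m) := by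
      ext x; ring
    have hgi : Integrable g μ := hgLp.integrable one_le_two
    have h1 : Integrable (fun x => L x * g x - m * L x) μ := hLg.sub (hL1.const_mul m)
    have h2 : Integrable (fun x => g x - m) μ := hgi.sub (integrable_const m)
    rw [e, integral_sub h1 h2,
      integral_sub hLg (hL1.const_mul m), integral_sub hgi (integrable_const m),
      integral_const_mul, hLone, ← hmg]
    simp
  have hchi : ∫ x, (L x - 1) ^ 2 ∂μ = (∫ x, L x ^ 2 ∂μ) - 1 := by
    have e : (fun x => (L x - 1) ^ 2) = fun x => (L x ^ 2 - 2 * L x) + 1 := by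
      ext x; ring
    have h1 : Integrable (fun x => L x ^ 2 - 2 * L x) μ :=
      hL2.integrable_sq.sub (hL1.const_mul 2)
    rw [e, integral_add h1 (integrable_const 1),
      integral_sub hL2.integrable_sq (hL1.const_mul 2), integral_const_mul, hLone]
    simp; ring
  -- Averaging out the randomization cannot increase variance: pointwise, `(g x - m)²` is at most
  -- the `κ x`-mean of `(f - m)²`.
  have hvar : ∫ x, (g x - m) ^ 2 ∂μ ≤ variance f (μ.bind κ) := by
    rw [variance_eq_integral hfm.aemeasurable, integral_bind_of_finite]
    refine integral_mono ((hgLp.sub (memLp_const m)).integrable_sq) ?_ fun x => ?_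
    · refine Integrable.of_bound (C := (B + |m|) ^ 2) ?_ (ae_of_all _ fun x => ?_)
      · exact (measurable_of_finite _).stronglyMeasurable.integral_kernel.aestronglyMeasurable
      · refine (norm_integral_le_of_norm_le_const (C := (B + |m|) ^ 2)
          (ae_of_all _ fun y => ?_)).trans (by simp)
        rw [norm_pow]
        gcongr
        exact (norm_sub_le _ _).trans (add_le_add (hB y) le_rfl)
    · have hv := variance_nonneg (fun y => f y - m) (κ x)
      rw [variance_eq_sub (.of_bound (measurable_of_finite _).aestronglyMeasurable (B + |m|)
        (ae_of_all _ fun y => (norm_sub_le _ _).trans (add_le_add (hB y) le_rfl)))] at hv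
      have e : ∫ y, (f y - m) ∂(κ x) = g x - m := by
        rw [integral_sub .of_finite (integrable_const m)]; simp [hg]
      rw [e] at hv
      simpa using hv
  rw [hleft, hdiff]
  refine (sq_integral_mul_le (hL2.sub (memLp_const 1)) (hgLp.sub (memLp_const m))).trans ?_
  simp only [Pi.sub_apply]
  rw [hchi]
  refine mul_le_mul_of_nonneg_left hvar ?_
  rw [← hchi]
  exact integral_nonneg fun x => sq_nonneg _

/-! ### Likelihood ratios of Gaussian product measures -/

/-- A product of measures with densities is the product measure with the product density. -/
lemma pi_withDensity {ι : Type*} [Fintype ι] {E : ι → Type*} [∀ i, MeasurableSpace (E i)]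
    (μ : (i : ι) → Measure (E i)) [∀ i, IsProbabilityMeasure (μ i)]
    {f : (i : ι) → E i → ENNReal} (hf : ∀ i, Measurable (f i))
    [∀ i, SigmaFinite ((μ i).withDensity (f i))] :
    Measure.pi (fun i => (μ i).withDensity (f i))
      = (Measure.pi μ).withDensity fun x => ∏ i, f i (x i) := by
  classical
  refine Measure.pi_eq fun s hs => ?_
  rw [withDensity_apply _ (.univ_pi hs), ← lintegral_indicator (.univ_pi hs)]
  have e : (Set.univ.pi s).indicator (fun x => ∏ i, f i (x i))
      = fun x => ∏ i, (s i).indicator (f i) (x i) := by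
    ext x
    by_cases hx : x ∈ Set.univ.pi s
    · rw [Set.indicator_of_mem hx]
      exact Finset.prod_congr rfl fun i _ =>
        (Set.indicator_of_mem (hx i (Set.mem_univ i)) _).symm
    · rw [Set.indicator_of_notMem hx]
      simp only [Set.mem_pi, Set.mem_univ, true_implies, not_forall] at hx
      obtain ⟨i, hi⟩ := hx
      exact (Finset.prod_eq_zero (Finset.mem_univ i) (Set.indicator_of_notMem hi _)).symm
  have hm : ∀ i, Measurable ((s i).indicator (f i)) := fun i => (hf i).indicator (hs i)
  -- The indicator of a box factors over independent coordinates, so its integral does too.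
  have hind := iIndepFun_pi (μ := μ) (X := fun i => (s i).indicator (f i))
    fun i => (hm i).aemeasurable
  have hp := lintegral_prod_eq_prod_lintegral_of_indepFun Finset.univ _ hind
    fun i => (hm i).comp (measurable_pi_apply i)
  rw [e, hp]
  refine Finset.prod_congr rfl fun i _ => ?_
  rw [withDensity_apply _ (hs i), ← lintegral_indicator (hs i),
    ← (measurePreserving_eval μ i).lintegral_comp (hm i)]

/-- The likelihood ratio of the unit-variance normal laws with means `m + d` and `m`. -/
noncomputable def gaussianRatio (m d x : ℝ) : ℝ := Real.exp (d * (x - m) - d ^ 2 / 2)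

lemma measurable_gaussianRatio (m d : ℝ) : Measurable (gaussianRatio m d) := by
  unfold gaussianRatio; fun_prop

lemma gaussianReal_eq_withDensity_gaussianRatio (m m' : ℝ) :
    gaussianReal m' 1
      = (gaussianReal m 1).withDensity fun x => ENNReal.ofReal (gaussianRatio m (m' - m) x) := by
  rw [gaussianReal_of_var_ne_zero m' one_ne_zero, gaussianReal_of_var_ne_zero m one_ne_zero,
    ← withDensity_mul _ (measurable_gaussianPDF m 1) (measurable_gaussianRatio _ _).ennreal_ofReal]
  congr 1
  ext x
  rw [Pi.mul_apply, gaussianPDF, gaussianPDF, ← ENNReal.ofReal_mul (gaussianPDFReal_nonneg _ _ _),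
    gaussianPDFReal, gaussianPDFReal, gaussianRatio, mul_assoc _ (Real.exp _) (Real.exp _), ← Real.exp_add]
  congr 3
  simp
  ring

/-- In this form the second moment of the ratio is the normal moment generating function at `2 * d`.
-/
lemma gaussianRatio_sq (m d x : ℝ) :
    gaussianRatio m d x ^ 2 = Real.exp (-(2 * d * m) - d ^ 2) * Real.exp (2 * d * x) := by
  rw [gaussianRatio, ← Real.exp_nat_mul, ← Real.exp_add]
  congr 1
  push_cast
  ring

lemma integrable_gaussianRatio_sq (m d : ℝ) :
    Integrable (fun x => gaussianRatio m d x ^ 2) (gaussianReal m 1) := by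
  simp_rw [gaussianRatio_sq]
  exact (integrable_exp_mul_gaussianReal _).const_mul _

lemma integral_gaussianRatio_sq (m d : ℝ) :
    ∫ x, gaussianRatio m d x ^ 2 ∂(gaussianReal m 1) = Real.exp (d ^ 2) := by
  have h := congrFun (mgf_id_gaussianReal (μ := m) (v := 1)) (2 * d)
  simp only [mgf, id] at h
  simp_rw [gaussianRatio_sq]
  rw [integral_const_mul, h, ← Real.exp_add]
  congr 1
  push_cast
  ring

/-- The mean of a statistic of a randomized function of independent unit-variance normal
variables moves by little when the means of these variables are changed. -/
lemma sq_integral_bind_pi_gaussianReal_sub_le {ι Y : Type*} [Fintype ι] [MeasurableSpace Y]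
    [Finite Y] [MeasurableSingletonClass Y] (m m' : ι → ℝ) (κ : Kernel (ι → ℝ) Y)
    [IsMarkovKernel κ] (f : Y → ℝ) :
    (∫ y, f y ∂((Measure.pi fun i => gaussianReal (m' i) 1).bind κ)
        - ∫ y, f y ∂((Measure.pi fun i => gaussianReal (m i) 1).bind κ)) ^ 2
      ≤ (Real.exp (∑ i, (m' i - m i) ^ 2) - 1)
        * variance f ((Measure.pi fun i => gaussianReal (m i) 1).bind κ) := by
  set L : (ι → ℝ) → ℝ := fun x => ∏ i, gaussianRatio (m i) (m' i - m i) (x i) with hLdef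
  have hL : Measurable L := by
    refine Finset.measurable_prod _ fun i _ => ?_
    exact (measurable_gaussianRatio _ _).comp (measurable_pi_apply i)
  have hL0 : ∀ x, 0 ≤ L x := fun x => Finset.prod_nonneg fun i _ => (Real.exp_pos _).le
  have hsq : (fun x => L x ^ 2)
      = fun x => ∏ i, gaussianRatio (m i) (m' i - m i) (x i) ^ 2 := by
    ext x; rw [hLdef, Finset.prod_pow]
  have hL2 : MemLp L 2 (Measure.pi fun i => gaussianReal (m i) 1) := by
    rw [memLp_two_iff_integrable_sq hL.aestronglyMeasurable, hsq]
    exact Integrable.fintype_prod fun i => integrable_gaussianRatio_sq _ _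
  have hd : (Measure.pi fun i => gaussianReal (m' i) 1)
      = (Measure.pi fun i => gaussianReal (m i) 1).withDensity fun x => ENNReal.ofReal (L x) := by
    have hp : ∀ i, IsProbabilityMeasure ((gaussianReal (m i) 1).withDensity
        fun x => ENNReal.ofReal (gaussianRatio (m i) (m' i - m i) x)) := fun i => by
      rw [← gaussianReal_eq_withDensity_gaussianRatio]; infer_instance
    refine (congrArg Measure.pi
      (funext fun i => gaussianReal_eq_withDensity_gaussianRatio (m i) (m' i))).trans ?_
    rw [pi_withDensity _ fun i => (measurable_gaussianRatio _ _).ennreal_ofReal]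
    congr 1
    ext x
    exact (ENNReal.ofReal_prod_of_nonneg fun i _ => (Real.exp_pos _).le).symm
  have hprob : IsProbabilityMeasure
      ((Measure.pi fun i => gaussianReal (m i) 1).withDensity
        fun x => ENNReal.ofReal (L x)) := by
    rw [← hd]; infer_instance
  have hint : ∫ x, L x ^ 2 ∂(Measure.pi fun i => gaussianReal (m i) 1)
      = Real.exp (∑ i, (m' i - m i) ^ 2) := by
    rw [hsq, integral_fintype_prod_eq_prod
      (f := fun i x => gaussianRatio (m i) (m' i - m i) x ^ 2), Real.exp_sum]
    exact Finset.prod_congr rfl fun i _ => integral_gaussianRatio_sq _ _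
  rw [hd, ← hint]
  exact sq_integral_bind_withDensity_sub_le _ κ f hL hL0 hL2

end Bandit

namespace Bandit

/-! ### Reduction to finitely many rewards -/

lemma observed_congr {K t : ℕ} {x y : RewardTable K} (h : ∀ i s, s < t → x (i, s) = y (i, s))
    (a : Fin t → Fin K) : observed x a = observed y a := by
  ext1 s
  refine Prod.ext rfl (h _ _ ?_)
  -- The reward index used at time `s` counts strictly earlier pulls, so it is at most `s`, hence
  -- below `t`.
  refine lt_of_le_of_lt (Finset.card_le_card (t := Finset.Iio s) fun u hu => ?_) ?_
  · simpa using (Finset.mem_filter.1 hu).2.1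
  · simp

/-- The first `t` actions depend on the first `t` rewards of every arm only. -/
lemma actionKernel_congr {K : ℕ} (π : Policy K) {t : ℕ} {x y : RewardTable K}
    (h : ∀ i s, s < t → x (i, s) = y (i, s)) : actionKernel π t x = actionKernel π t y := by
  induction t with
  | zero => rfl
  | succ t ih =>
    have h' : ∀ i s, s < t → x (i, s) = y (i, s) := fun i s hs => h i s (hs.trans t.lt_succ_self)
    have hm : Measurable (fun q : (Fin t → Fin K) × Fin K =>
      (Fin.snoc q.1 q.2 : Fin (t + 1) → Fin K)) := .of_discrete
    unfold actionKernel
    rw [Kernel.map_apply _ hm, Kernel.map_apply _ hm]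
    congr 1
    ext s hs
    rw [Kernel.compProd_apply hs, Kernel.compProd_apply hs, ih h']
    simp only [Kernel.comap_apply, observed_congr h']

/-- The extension by zero of the first `T` rewards of every arm to a reward table. -/
noncomputable def extendTable {K : ℕ} (T : ℕ)
    (z : (Finset.univ ×ˢ Finset.range T : Finset (Fin K × ℕ)) → ℝ) : RewardTable K :=
  fun p => if hp : p ∈ (Finset.univ ×ˢ Finset.range T : Finset (Fin K × ℕ)) then z ⟨p, hp⟩ else 0

lemma measurable_extendTable {K : ℕ} (T : ℕ) : Measurable (extendTable (K := K) T) := by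
  refine measurable_pi_lambda _ fun p => ?_
  unfold extendTable
  split_ifs with hp
  · exact measurable_pi_apply _
  · exact measurable_const

/-- This replaces the infinite reward table by a finite product, where the likelihood ratio is a
finite product of Gaussian ratios. -/
lemma actionLaw_eq_bind_pi {K : ℕ} (π : Policy K) (ν : Instance K) (T : ℕ) :
    actionLaw π ν T
      = (Measure.pi fun p : (Finset.univ ×ˢ Finset.range T : Finset (Fin K × ℕ)) =>
          (ν p.1.1 : Measure ℝ)).bind
        ((actionKernel π T).comap (extendTable T) (measurable_extendTable T)) := by
  have hr := Measure.infinitePi_map_restrict (μ := fun p : Fin K × ℕ => (ν p.1 : Measure ℝ))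
    (I := Finset.univ ×ˢ Finset.range T)
  have hm : Measurable (Finset.univ ×ˢ Finset.range T : Finset (Fin K × ℕ)).restrict :=
    Finset.measurable_restrict (X := fun _ => ℝ) _
  rw [← hr, Measure.bind]
  erw [Measure.map_map (Kernel.measurable _) hm]
  rw [actionLaw, Measure.bind, rewardLaw]
  congr 2
  ext1 x
  refine actionKernel_congr π fun i s hs => ?_
  simp [extendTable, hs]

instance {K : ℕ} (π : Policy K) (ν : Instance K) (T : ℕ) :
    IsProbabilityMeasure (actionLaw π ν T) := by
  have : actionLaw π ν T = actionKernel π T ∘ₘ rewardLaw ν := rfl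
  rw [this, rewardLaw]
  infer_instance

/-- Sensitivity of the expected pull counts to the means of unit-variance normal arms. -/
lemma sq_expectedPulls_sub_le {K : ℕ} (π : Policy K) {ν ν' : Instance K} {m m' : Fin K → ℝ}
    (hν : ∀ i, (ν i : Measure ℝ) = gaussianReal (m i) 1)
    (hν' : ∀ i, (ν' i : Measure ℝ) = gaussianReal (m' i) 1) (T : ℕ) (i : Fin K) :
    (expectedPulls π ν' T i - expectedPulls π ν T i) ^ 2
      ≤ (Real.exp (T * ∑ j, (m' j - m j) ^ 2) - 1)
        * variance (fun a : Fin T → Fin K => (pullCount i a : ℝ)) (actionLaw π ν T) := by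
  have h := sq_integral_bind_pi_gaussianReal_sub_le
    (fun p : (Finset.univ ×ˢ Finset.range T : Finset (Fin K × ℕ)) => m p.1.1)
    (fun p => m' p.1.1)
    ((actionKernel π T).comap (extendTable T) (measurable_extendTable T))
    (fun a => (pullCount i a : ℝ))
  have hs : ∑ p : (Finset.univ ×ˢ Finset.range T : Finset (Fin K × ℕ)),
      (m' p.1.1 - m p.1.1) ^ 2 = T * ∑ j, (m' j - m j) ^ 2 := by
    rw [Finset.sum_coe_sort (Finset.univ ×ˢ Finset.range T : Finset (Fin K × ℕ))
      (fun p => (m' p.1 - m p.1) ^ 2), Finset.sum_product, Finset.mul_sum]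
    simp
  rw [hs] at h
  simp_rw [← hν, ← hν'] at h
  rwa [← actionLaw_eq_bind_pi, ← actionLaw_eq_bind_pi] at h

/-! ### Pull counts, regret and allocation variability -/

lemma pullCount_le {K t : ℕ} (i : Fin K) (a : Fin t → Fin K) : pullCount i a ≤ t :=
  (Finset.card_le_univ _).trans (by simp)

lemma expectedPulls_nonneg {K : ℕ} (π : Policy K) (ν : Instance K) (T : ℕ) (i : Fin K) :
    0 ≤ expectedPulls π ν T i := integral_nonneg fun _ => Nat.cast_nonneg _

lemma sum_expectedPulls {K : ℕ} (π : Policy K) (ν : Instance K) (T : ℕ) :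
    ∑ i, expectedPulls π ν T i = T := by
  unfold expectedPulls
  rw [← integral_finsetSum _ fun i _ => .of_finite]
  have h : ∀ a : Fin T → Fin K, ∑ i, (pullCount i a : ℝ) = T := fun a => by
    have := Finset.card_eq_sum_card_fiberwise (f := a) (s := Finset.univ) (t := Finset.univ)
      (by simp)
    unfold pullCount
    rw [← Nat.cast_sum, ← this]
    simp
  simp [h]

lemma gap_nonneg {K : ℕ} (ν : Instance K) (i : Fin K) : 0 ≤ gap ν i :=
  sub_nonneg.2 (le_ciSup (Set.finite_range _).bddAbove i)

lemma sqrt_variance_pullCount_le_allocVar {K : ℕ} (π : Policy K) (ν : Instance K) (T : ℕ)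
    (i : Fin K) :
    √(variance (fun a : Fin T → Fin K => (pullCount i a : ℝ)) (actionLaw π ν T))
      ≤ allocVar π ν T :=
  le_ciSup (f := fun i : Fin K =>
    √(variance (fun a : Fin T → Fin K => (pullCount i a : ℝ)) (actionLaw π ν T)))
    (Set.finite_range _).bddAbove i

lemma allocVar_nonneg {K : ℕ} (π : Policy K) (ν : Instance K) (T : ℕ) : 0 ≤ allocVar π ν T :=
  Real.iSup_nonneg fun _ => Real.sqrt_nonneg _

lemma allocVar_le {K : ℕ} (π : Policy K) (ν : Instance K) (T : ℕ) : allocVar π ν T ≤ T := by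
  refine Real.iSup_le (fun i => ?_) (Nat.cast_nonneg T)
  refine Real.sqrt_le_iff.2 ⟨Nat.cast_nonneg T, ?_⟩
  refine (variance_le_sq_of_bounded (a := 0) (b := T) (ae_of_all _ fun a => ?_)
    (measurable_of_finite _).aemeasurable).trans ?_
  · exact ⟨Nat.cast_nonneg _, Nat.cast_le.2 (pullCount_le i a)⟩
  · have : (0 : ℝ) ≤ T := Nat.cast_nonneg T
    nlinarith

lemma regret_le_worstRegret {M : ℝ} {σ : ℝ≥0} {Kbar K : ℕ} (A : Algorithm) (T : ℕ) (hK : 2 ≤ K)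
    {ν : Instance K} (hν : InClass M σ Kbar ν) :
    regret (A T K hK) ν T ≤ worstRegret M σ Kbar A T := by
  -- A bound on the set is essential, as the real `sSup` of an unbounded set is `0`; gaps are at
  -- most `2M` and pull counts sum to `T`.
  refine le_csSup ⟨2 * M * T, ?_⟩ ⟨K, hK, ν, hν, rfl⟩
  rintro r ⟨K, hK, ν, hν, rfl⟩
  have : Nonempty (Fin K) := ⟨⟨0, by omega⟩⟩
  rw [regret, ← sum_expectedPulls (A T K hK) ν T, Finset.mul_sum]
  refine Finset.sum_le_sum fun i _ =>
    mul_le_mul_of_nonneg_right ?_ (expectedPulls_nonneg _ _ _ _)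
  have h1 : ⨆ j, mean ν j ≤ M := ciSup_le fun j => (hν.2.2 j).1.2
  have h2 := (hν.2.2 i).1.1
  rw [gap]
  linarith

/-! ### The two-armed Gaussian family -/

/-- The means of the two arms of `gaussianPair Δ`. -/
def pairMeans (Δ : ℝ) : Fin 2 → ℝ := ![0, -Δ]

lemma gaussianPair_apply (Δ : ℝ) (i : Fin 2) :
    (gaussianPair Δ i : Measure ℝ) = gaussianReal (pairMeans Δ i) 1 := by
  fin_cases i <;> rfl

lemma mean_gaussianPair (Δ : ℝ) (i : Fin 2) : mean (gaussianPair Δ) i = pairMeans Δ i := by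
  rw [mean, gaussianPair_apply, integral_id_gaussianReal]

lemma inClass_gaussianPair {M Δ : ℝ} {σ : ℝ≥0} {Kbar : ℕ} (hM : 0 < M) (hσ : 1 ≤ σ)
    (hKbar : 2 ≤ Kbar) (h0 : 0 ≤ Δ) (hΔ : Δ ≤ M) : InClass M σ Kbar (gaussianPair Δ) := by
  refine ⟨le_rfl, hKbar, fun i => ⟨?_, ?_⟩⟩
  · rw [mean_gaussianPair]
    fin_cases i <;> constructor <;> simp [pairMeans] <;> linarith
  · rw [mean_gaussianPair, gaussianPair_apply]
    have hmap : (gaussianReal (pairMeans Δ i) 1).map (fun x => x - pairMeans Δ i)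
        = gaussianReal 0 1 := by
      rw [gaussianReal_map_sub_const, sub_self]
    have hX : AEMeasurable (fun x => x - pairMeans Δ i) (gaussianReal (pairMeans Δ i) 1) := by
      fun_prop
    refine ⟨fun t => ?_, fun t => ?_⟩
    · have h := integrable_exp_mul_gaussianReal (μ := 0) (v := 1) t
      rw [← hmap] at h
      exact h.comp_aemeasurable hX
    · rw [mgf_gaussianReal hmap]
      refine Real.exp_le_exp.2 ?_
      have h1 : (1 : ℝ) ≤ (σ : ℝ) ^ 2 := one_le_pow₀ (by exact_mod_cast hσ)
      push_cast
      nlinarith [mul_le_mul_of_nonneg_right h1 (sq_nonneg t)]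

lemma mul_expectedPulls_gaussianPair_le_regret (π : Policy 2) (T : ℕ) (Δ : ℝ) :
    Δ * expectedPulls π (gaussianPair Δ) T 1 ≤ regret π (gaussianPair Δ) T := by
  have h0 : (0 : ℝ) ≤ ⨆ j, mean (gaussianPair Δ) j := by
    have := le_ciSup (f := mean (gaussianPair Δ)) (Set.finite_range _).bddAbove 0
    rwa [mean_gaussianPair] at this
  have h1 : mean (gaussianPair Δ) 1 = -Δ := mean_gaussianPair Δ 1
  rw [regret, Fin.sum_univ_two]
  have h2 := mul_nonneg (gap_nonneg (gaussianPair Δ) 0)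
    (expectedPulls_nonneg π (gaussianPair Δ) T 0)
  have h3 : Δ ≤ gap (gaussianPair Δ) 1 := by rw [gap, h1]; linarith
  have h4 := mul_le_mul_of_nonneg_right h3 (expectedPulls_nonneg π (gaussianPair Δ) T 1)
  linarith

lemma expectedPulls_gaussianPair_zero {M : ℝ} {σ : ℝ≥0} {Kbar : ℕ} {A : Algorithm}
    (hA : IsRegular M σ Kbar A) (hM : 0 < M) (hσ : 1 ≤ σ) (hKbar : 2 ≤ Kbar) (T : ℕ) :
    expectedPulls (A T 2 le_rfl) (gaussianPair 0) T 1 = T / 2 := by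
  have h := (hA T 2 le_rfl (gaussianPair 0)
    (inClass_gaussianPair hM hσ hKbar le_rfl hM.le)).1 0 1 (by
      simp only [gaussianPair, neg_zero]
      rfl)
  have hs := sum_expectedPulls (A T 2 le_rfl) (gaussianPair 0) T
  rw [Fin.sum_univ_two, h] at hs
  linarith

lemma exp_sub_one_le_two_mul {x : ℝ} (h0 : 0 ≤ x) (h1 : x ≤ 1) : Real.exp x - 1 ≤ 2 * x := by
  have h := Real.abs_exp_sub_one_le (x := x) (by rwa [abs_of_nonneg h0])
  rw [abs_of_nonneg h0] at h
  exact (le_abs_self _).trans h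

/-- One small step of the gap moves the expected pull count of the second arm by little. -/
lemma abs_expectedPulls_gaussianPair_sub_le (π : Policy 2) (T : ℕ) {Δ δ S : ℝ} (hδ : 0 ≤ δ)
    (hδT : T * δ ^ 2 ≤ 1) (hS : allocVar π (gaussianPair Δ) T ≤ S) :
    |expectedPulls π (gaussianPair (Δ + δ)) T 1 - expectedPulls π (gaussianPair Δ) T 1|
      ≤ 2 * (δ * √T) * S := by
  have hS0 := (allocVar_nonneg π (gaussianPair Δ) T).trans hS
  have h := sq_expectedPulls_sub_le π (gaussianPair_apply Δ) (gaussianPair_apply (Δ + δ)) T 1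
  have hsum : ∑ j, (pairMeans (Δ + δ) j - pairMeans Δ j) ^ 2 = δ ^ 2 := by
    simp [Fin.sum_univ_two, pairMeans]
  have hT : (0 : ℝ) ≤ T := Nat.cast_nonneg T
  have hV := (Real.sqrt_le_iff.1
    ((sqrt_variance_pullCount_le_allocVar π (gaussianPair Δ) T 1).trans hS)).2
  rw [hsum] at h
  refine abs_le_of_sq_le_sq (h.trans ?_) (by positivity)
  calc _ ≤ (2 * (T * δ ^ 2)) * S ^ 2 :=
        mul_le_mul (exp_sub_one_le_two_mul (by positivity) hδT) hV (variance_nonneg _ _)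
          (by positivity)
    _ ≤ (2 * (δ * √T) * S) ^ 2 := by
        rw [mul_pow, mul_pow, mul_pow, Real.sq_sqrt hT]
        nlinarith [mul_nonneg (mul_nonneg hT (sq_nonneg δ)) (sq_nonneg S)]

/-- A change of the gap by `b` moves the expected pull count of the second arm by at most
`2 b √T` times the largest allocation variability on the way. -/
lemma abs_expectedPulls_gaussianPair_sub_zero_le (π : Policy 2) (T : ℕ) {b S : ℝ} (hb : 0 ≤ b)
    (hS : ∀ Δ ∈ Set.Icc 0 b, allocVar π (gaussianPair Δ) T ≤ S) :
    |expectedPulls π (gaussianPair b) T 1 - expectedPulls π (gaussianPair 0) T 1|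
      ≤ 2 * (b * √T) * S := by
  have hT : (0 : ℝ) ≤ T := Nat.cast_nonneg T
  -- With more than `b√T` steps, each step satisfies `Tδ² ≤ 1`, the range where `exp x - 1 ≤ 2x`
  -- applies.
  obtain ⟨n, hn⟩ := exists_nat_gt (b * √T)
  have hn0 : (0 : ℝ) < n := lt_of_le_of_lt (by positivity) hn
  set δ := b / n with hδ
  have hδ0 : 0 ≤ δ := by positivity
  have hδn : n * δ = b := by rw [hδ]; field_simp
  have hδT : T * δ ^ 2 ≤ 1 := by
    have h1 : δ * √T ≤ 1 := by
      rw [hδ, div_mul_eq_mul_div]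
      exact (div_le_one hn0).2 hn.le
    have h2 : (δ * √T) ^ 2 ≤ 1 := pow_le_one₀ (by positivity) h1
    rwa [mul_pow, Real.sq_sqrt hT, mul_comm] at h2
  have key : ∀ k : ℕ, k ≤ n →
      |expectedPulls π (gaussianPair (k * δ)) T 1 - expectedPulls π (gaussianPair 0) T 1|
        ≤ k * (2 * (δ * √T) * S) := by
    intro k
    induction k with
    | zero => simp
    | succ k ih =>
      intro hk
      have hkb : (k : ℝ) * δ ≤ b := by
        rw [← hδn]
        gcongr
        omega
      -- Only the variance at the left endpoint `kδ ∈ [0, b]` enters.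
      have hstep := abs_expectedPulls_gaussianPair_sub_le π T hδ0 hδT
        (hS _ ⟨by positivity, hkb⟩)
      have e : ((k + 1 : ℕ) : ℝ) * δ = k * δ + δ := by push_cast; ring
      rw [e]
      refine (abs_sub_le _ (expectedPulls π (gaussianPair (k * δ)) T 1) _).trans ?_
      push_cast
      linarith [ih (by omega)]
  have h := key n le_rfl
  rw [hδn] at h
  refine h.trans_eq ?_
  rw [← hδn]
  ring

end Bandit

/-! ### The lower bound on allocation variability -/

theorem corollary3 (C : ℝ) (hC : 0 < C) :
    ∃ c : ℝ, 0 < c ∧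
      ∀ (M : ℝ) (σ : ℝ≥0) (Kbar : ℕ), 0 < M → 1 ≤ σ → 2 ≤ Kbar →
      ∀ α : ℝ, 0 ≤ α → α < 1 / 2 →
      ∀ A : Bandit.Algorithm,
        Bandit.IsRegular M σ Kbar A →
        Bandit.IsActiveLearning M σ Kbar A →
        (fun T : ℕ => Bandit.worstRegret M σ Kbar A T) =Θ[atTop]
          (fun T : ℕ => (T : ℝ) ^ (1 / 2 + α)) →
        (∀ᶠ T : ℕ in atTop, Bandit.worstRegret M σ Kbar A T ≤ C * (T : ℝ) ^ (1 / 2 + α)) →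
        (fun T : ℕ => (T : ℝ) ^ (1 - α)) =O[atTop]
          (fun T : ℕ => sSup (Bandit.gaussianAllocVar A T ''
            Set.Icc 0 (c * (T : ℝ) ^ (α - 1 / 2)))) := by
  -- The factor `8` turns the regret bound into `𝔼[N₂] ≤ T/8`; any factor above `2` would separate
  -- it from `T/2`.
  refine ⟨8 * C, by positivity, fun M σ Kbar hM hσ hKbar α _ hα A hreg _ _ hup => ?_⟩
  have hb0 : Tendsto (fun T : ℕ => 8 * C * (T : ℝ) ^ (α - 1 / 2)) atTop (𝓝 0) := by
    have h := (tendsto_rpow_neg_atTop (y := 1 / 2 - α) (by linarith)).comp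
      tendsto_natCast_atTop_atTop
    have h' := h.const_mul (8 * C)
    rw [mul_zero, neg_sub] at h'
    exact h'
  -- Solving `3T/8 ≤ 2(8C T^α) S` for `T^(1-α)` gives this constant.
  refine IsBigO.of_bound (16 * (8 * C) / 3) ?_
  -- Since `α < 1/2`, `b` tends to `0`, so eventually `b ≤ M` and the instance lies in the class.
  filter_upwards [hup, hb0.eventually (Iic_mem_nhds hM), eventually_ge_atTop 1]
    with T hT hbM hT1
  have hTpos : (0 : ℝ) < T := by exact_mod_cast hT1
  set b := 8 * C * (T : ℝ) ^ (α - 1 / 2) with hb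
  have hbpos : 0 < b := by positivity
  set S := sSup (Bandit.gaussianAllocVar A T '' Set.Icc 0 b)
  have hS : ∀ Δ ∈ Set.Icc 0 b,
      Bandit.allocVar (A T 2 le_rfl) (Bandit.gaussianPair Δ) T ≤ S := fun Δ hΔ =>
    le_csSup ⟨T, by rintro _ ⟨Δ, _, rfl⟩; exact Bandit.allocVar_le _ _ _⟩ ⟨Δ, hΔ, rfl⟩
  have hS0 : 0 ≤ S := (Bandit.allocVar_nonneg _ _ _).trans (hS 0 ⟨le_rfl, hbpos.le⟩)
  have hchange := Bandit.abs_expectedPulls_gaussianPair_sub_zero_le (A T 2 le_rfl) T hbpos.le hS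
  rw [Bandit.expectedPulls_gaussianPair_zero hreg hM hσ hKbar] at hchange
  have hlow : Bandit.expectedPulls (A T 2 le_rfl) (Bandit.gaussianPair b) T 1 ≤ T / 8 := by
    have h := ((Bandit.mul_expectedPulls_gaussianPair_le_regret (A T 2 le_rfl) T b).trans
      (Bandit.regret_le_worstRegret A T le_rfl
        (Bandit.inClass_gaussianPair hM hσ hKbar hbpos.le hbM))).trans hT
    have e : C * (T : ℝ) ^ (1 / 2 + α) = b * (T / 8) := by
      have : (T : ℝ) ^ (1 / 2 + α) = (T : ℝ) ^ (α - 1 / 2) * T := by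
        rw [← Real.rpow_add_one hTpos.ne']
        congr 1
        ring
      rw [this, hb]
      ring
    rw [e] at h
    exact le_of_mul_le_mul_left h hbpos
  have hbT : b * √T = 8 * C * (T : ℝ) ^ α := by
    rw [hb, Real.sqrt_eq_rpow, mul_assoc, ← Real.rpow_add hTpos]
    congr 2
    ring
  have hmain : 3 / 8 * (T : ℝ) ≤ 2 * (8 * C * (T : ℝ) ^ α) * S := by
    rw [hbT] at hchange
    linarith [(abs_le.1 hchange).1]
  rw [Real.norm_of_nonneg (by positivity), Real.norm_of_nonneg hS0, Real.rpow_sub hTpos,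
    Real.rpow_one, div_le_iff₀ (by positivity)]
  linarith
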